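/- Let $R$ be an associative ring with unity and let $G$ be a subgroup of the group of units $R^*$. An equation over $R$ in unknowns $x_1,\dots,x_m$ is a finite formal expression $\sum_i\prod_j c_{ij}x_{ij}^{k_{ij}}=0$ with coefficients $c_{ij}\in R$, $x_{ij}\in\{x_1,\dots,x_m\}$ and $k_{ij}\in\mathbb Z$; a system is a (not necessarily finite) set of such equations. A system is called generalised homogeneous modulo an integer $n\ge 0$ if there is a map $\deg\colon\{x_1,\dots,x_m\}\to\mathbb Z/n\mathbb Z$ whose values generate the group $\mathbb Z/n\mathbb Z$ and such that, in each equation of the system, the degree $\sum_j k_{ij}\deg(x_{ij})\in\mathbb Z/n\mathbb Z$ of the $i$-th monomial does not depend on $i$ (it may depend on the equation). The homogeneity modulus $n_0$ of the system is the largest $n$ such that the system is generalised homogeneous modulo $n$, or $0$ if there are infinitely many such $n$. For a group $K$ and an integer $n\ge 0$ let $\mathrm{GCD}(K,n)$ be the least common multiple of the orders of all subgroups of $K$ whose order divides $n$. Divisibility is understood in the sense of cardinal arithmetic: a cardinal $a$ divides a cardinal $b$ if $b=a\cdot c$ for some cardinal $c$ (so an infinite cardinal is divisible by all nonzero cardinals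 not exceeding it, and $0$ is divisible by all cardinals and divides only $0$); the least common multiple of a set of nonzero cardinals is its least nonzero common multiple. In particular, $\mathrm{GCD}(K,0)=|K|$, and $\mathrm{GCD}(K,n)$ is the usual greatest common divisor of $|K|$ and $n$ if $K$ is finite. **Theorem.** For each system of equations over $R$ in $m$ unknowns, the number (cardinality of the set) of its solutions lying in $G^m$ is divisible by $\mathrm{GCD}(G_0,n_0)$, where $n_0$ is the homogeneity modulus of the system and $G_0$ is the subgroup of all elements of $G$ that commute with all coefficients of the system. -/

import Mathlib

universe u

/-- A factor `c * x_i ^ k` of a monomial: a coefficient `c` from the ring, one of the unknowns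
`x_0, …, x_{m-1}`, and an integer exponent `k`. -/
structure RingFactor (R : Type u) (m : ℕ) where
  coeff : R
  unknown : Fin m
  exponent : ℤ

/-- A (noncommutative) monomial `∏ j, c_j * x_j ^ k_j`, as a formal ordered product. -/
abbrev RingMonomial (R : Type u) (m : ℕ) := List (RingFactor R m)

/-- An equation `∑ i, ∏ j, c_ij * x_ij ^ k_ij = 0`; the list is the list of the terms of the
formal finite sum on the left-hand side. -/
abbrev RingEquation (R : Type u) (m : ℕ) := List (RingMonomial R m)

/-- A (not necessarily finite) system of equations over `R` in `m` unknowns. -/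
abbrev RingSystem (R : Type u) (m : ℕ) := Set (RingEquation R m)

namespace RingMonomial

variable {R : Type u} {m : ℕ}

/-- The value of a monomial at a tuple of units. -/
def eval [Ring R] (t : RingMonomial R m) (x : Fin m → Rˣ) : R :=
  (t.map fun f => f.coeff * ((x f.unknown ^ f.exponent : Rˣ) : R)).prod

/-- The degree `∑ j, k_j * deg x_j` of a monomial, for degrees of the unknowns in `ℤ/nℤ`. -/
def degree {n : ℕ} (t : RingMonomial R m) (deg : Fin m → ZMod n) : ZMod n :=
  (t.map fun f => (f.exponent : ZMod n) * deg f.unknown).sum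

end RingMonomial

/-- The value of the left-hand side of an equation at a tuple of units. -/
def RingEquation.eval {R : Type u} [Ring R] {m : ℕ} (e : RingEquation R m)
    (x : Fin m → Rˣ) : R :=
  (e.map fun t => RingMonomial.eval t x).sum

namespace RingSystem

variable {R : Type u} {m : ℕ}

/-- The set of all coefficients occurring in the system. -/
def coeffs (S : RingSystem R m) : Set R :=
  {c | ∃ e ∈ S, ∃ t ∈ e, ∃ f ∈ t, f.coeff = c}

/-- The set of the solutions of the system lying in `G ^ m`. -/
def solutions [Ring R] (S : RingSystem R m) (G : Subgroup Rˣ) : Set (Fin m → G) :=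
  {x | ∀ e ∈ S, RingEquation.eval e (fun i => (x i : Rˣ)) = 0}

/-- The system is generalised homogeneous modulo `n`: for some degrees of the unknowns in `ℤ/nℤ`,
which generate `ℤ/nℤ`, in each equation all monomials have the same degree (which may depend on the
equation). -/
def IsHomogeneousMod (S : RingSystem R m) (n : ℕ) : Prop :=
  ∃ deg : Fin m → ZMod n, AddSubgroup.closure (Set.range deg) = ⊤ ∧
    ∀ e ∈ S, ∃ d : ZMod n, ∀ t ∈ e, RingMonomial.degree t deg = d

open Classical in
/-- The homogeneity modulus: the largest `n` such that the system is generalised homogeneous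
modulo `n`, or zero if there are infinitely many such `n`. -/
noncomputable def homogeneityModulus (S : RingSystem R m) : ℕ :=
  if {n | S.IsHomogeneousMod n}.Finite then sSup {n | S.IsHomogeneousMod n} else 0

end RingSystem

/-- The least common multiple of a set of cardinals: the least nonzero common multiple (zero, if
there is no nonzero common multiple). -/
noncomputable def cardinalLCM (A : Set Cardinal.{u}) : Cardinal.{u} :=
  sInf {c | c ≠ 0 ∧ ∀ a ∈ A, a ∣ c}

/-- `GCD(G, n)` for a group `G` and an integer `n ≥ 0`: the least common multiple of the orders of
those subgroups of `G` whose order divides `n`, in the sense of cardinal arithmetic. -/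
noncomputable def groupGCD (G : Type u) [Group G] (n : ℕ) : Cardinal.{u} :=
  cardinalLCM {a | ∃ H : Subgroup G, a = Cardinal.mk H ∧ a ∣ (n : Cardinal.{u})}

/-!
A tuple in `G ^ m` is a homomorphism `φ` from the free group `F` on the unknowns to `G`, and the
degrees define an epimorphism `D : F → ℤ/n`; let `D t = 1`. Let `H ≤ G` commute with the
coefficients and have order dividing `n`. It acts on the solutions by conjugation. Let `C` be the
centraliser of `φ (ker D)` in the largest subgroup of `H` normalised by `φ F`. Then
`(φ t * c) ^ n = φ t ^ n` for each `c ∈ C`, by a variant of Frobenius' theorem, so that `φ` can be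
changed into a homomorphism that is unchanged on `ker D` and has the value `φ t * c` at `t`. This
twist multiplies all monomials of a homogeneous equation by the same unit on the right, so it
preserves solutions. Twisting is an equivalence relation, the class of `φ` has `|C|` elements, and
`C` is also its stabiliser in `H`; by Burnside's double count `|H|` divides the number of solutions.

Homogeneity modulo `n` means that a fixed finitely generated abelian group surjects onto `ℤ/n`. If
this happens for infinitely many `n`, that group is infinite and surjects onto `ℤ`, so the
homogeneity modulus is itself a modulus of homogeneity.
-/

universe v

open Cardinal

section Counting

variable {K : Type u} {X : Type v} [Group K]

-- Burnside's double count of the pairs `(q, g)` with `g • q = q`.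
theorem lift_mk_dvd_lift_mk_of_fiber_equiv_stabilizer {Q : Type v} [MulAction K Q] (π : X → Q)
    (h : ∀ q, Nonempty ({x // π x = q} ≃ MulAction.stabilizer K q)) :
    lift.{v} #K ∣ lift.{u} #X := by
  let swap : (Σ q : Q, MulAction.stabilizer K q) ≃ Σ g : K, MulAction.fixedBy Q g :=
    { toFun p := ⟨p.2.1, p.1, p.2.2⟩
      invFun p := ⟨p.2.1, p.1, p.2.2⟩ }
  have count : X ≃ Quotient (MulAction.orbitRel K Q) × K :=
    calc X ≃ Σ q, {x // π x = q} := (Equiv.sigmaFiberEquiv π).symm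
      _ ≃ Σ q, MulAction.stabilizer K q := Equiv.sigmaCongrRight fun q => (h q).some
      _ ≃ Σ g, MulAction.fixedBy Q g := swap
      _ ≃ Quotient (MulAction.orbitRel K Q) × K := MulAction.sigmaFixedByEquivOrbitsProdGroup K Q
  rw [← lift_umax.{v, u}, lift_mk_eq'.mpr ⟨count⟩]
  simp

/-- The action on the classes of an equivalence relation induced by an action that preserves
this relation. -/
abbrev quotientMulAction [MulAction K X] (r : Setoid X)
    (hr : ∀ (g : K) {x y : X}, r x y → r (g • x) (g • y)) : MulAction K (Quotient r) where
  smul g := Quotient.map (g • ·) fun _ _ => hr g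
  one_smul := by
    rintro ⟨x⟩
    exact congrArg (Quotient.mk r) (one_smul K x)
  mul_smul g h := by
    rintro ⟨x⟩
    exact congrArg (Quotient.mk r) (mul_smul g h x)

theorem lift_mk_dvd_lift_mk_of_class_equiv_stabilizer [MulAction K X] (r : Setoid X)
    (hr : ∀ (g : K) {x y : X}, r x y → r (g • x) (g • y))
    (hclass : ∀ x, Nonempty ({y // r x y} ≃ {g : K // r x (g • x)})) :
    lift.{v} #K ∣ lift.{u} #X := by
  let _ := quotientMulAction r hr
  refine lift_mk_dvd_lift_mk_of_fiber_equiv_stabilizer (Quotient.mk r) ?_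
  rintro ⟨x⟩
  obtain ⟨e⟩ := hclass x
  exact ⟨(Equiv.subtypeEquivRight fun y => Quotient.eq.trans r.comm').trans
    (e.trans (Equiv.subtypeEquivRight fun g => r.comm'.trans Quotient.eq.symm))⟩

end Counting

section PowMulCoset

theorem dvd_natCard_of_dvd_minimalPeriod {X : Type*} [Finite X] (π : Equiv.Perm X) {d : ℕ}
    (hd : ∀ x, d ∣ Function.minimalPeriod π x) : d ∣ Nat.card X := by
  classical
  have := Fintype.ofFinite X
  rw [Nat.card_congr (MulAction.selfEquivSigmaOrbits (Subgroup.zpowers π) X), Nat.card_sigma]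
  refine Finset.dvd_sum fun ω _ => ?_
  rw [Nat.card_eq_fintype_card, ← MulAction.minimalPeriod_eq_card (a := π) (b := ω.out)]
  exact hd _

theorem pow_factorization_add_one_dvd_of_mul_dvd_lcm {n k p : ℕ} (hp : p.Prime) (hn : n ≠ 0)
    (h : n * p ∣ n.lcm k) : p ^ (n.factorization p + 1) ∣ k := by
  rcases eq_or_ne k 0 with rfl | hk
  · exact dvd_zero _
  have hlcm : p ^ (n.factorization p + 1) ∣ n.lcm k :=
    (pow_succ p _ ▸ mul_dvd_mul_right (Nat.ordProj_dvd n p) p).trans h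
  rw [hp.pow_dvd_iff_le_factorization (Nat.lcm_ne_zero hn hk), Nat.factorization_lcm hn hk,
    Finsupp.sup_apply, le_sup_iff] at hlcm
  exact (hp.pow_dvd_iff_le_factorization hk).mpr (hlcm.resolve_left (by lia))

variable {U : Type*} [Group U]

theorem mul_orderOf_dvd_lcm_of_semiconjBy {x y u : U} {n k : ℕ}
    (hu : SemiconjBy u (y ^ k) (x ^ k)) (hxu : Commute (x ^ n) u) (hxy : Commute (x ^ n) y) :
    n * orderOf ((x ^ n)⁻¹ * y ^ n) ∣ n.lcm k := by
  obtain ⟨r, hr⟩ := Nat.dvd_lcm_left n k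
  obtain ⟨s, hs⟩ := Nat.dvd_lcm_right n k
  have hpow : y ^ (n * r) = x ^ (n * r) := by
    have hu' : SemiconjBy u (y ^ (n * r)) (x ^ (n * r)) := by
      rw [← hr, hs, pow_mul, pow_mul]
      exact hu.pow_right s
    have hxu' : Commute (x ^ (n * r)) u := by
      rw [pow_mul]
      exact hxu.pow_left r
    exact mul_left_cancel (hu'.eq.trans hxu'.eq)
  rw [hr]
  refine mul_dvd_mul_left n (orderOf_dvd_of_pow_eq_one ?_)
  rw [(hxy.pow_right n).inv_left.mul_pow, inv_pow, ← pow_mul, ← pow_mul, hpow, inv_mul_cancel]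

/-- The permutation `u ↦ x⁻¹ u x c` of a subgroup normalised by `x` and containing `c`; an element
of a cycle of length `k` conjugates `(x c)ᵏ` to `xᵏ`. -/
def conjMulPerm (C : Subgroup U) (x : Subgroup.normalizer (C : Set U)) (c : C) : Equiv.Perm C :=
  (C.normalizerMonoidHom x⁻¹).toEquiv.trans (Equiv.mulRight c)

theorem coe_conjMulPerm_iterate (C : Subgroup U) (x : Subgroup.normalizer (C : Set U)) (c u : C)
    (k : ℕ) :
    ((conjMulPerm C x c)^[k] u : U) = ((x : U) ^ k)⁻¹ * u * (x * c : U) ^ k := by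
  induction k with
  | zero => simp
  | succ k ih =>
    have hstep (v : C) : (conjMulPerm C x c v : U) = (x : U)⁻¹ * v * (x * c) := by
      change (x : U)⁻¹ * v * (x : U)⁻¹⁻¹ * c = _
      group
    rw [Function.iterate_succ_apply', hstep, ih, pow_succ, pow_succ]
    group

theorem mul_pow_eq_pow_of_natCard_dvd {C : Subgroup U} {n : ℕ} (hC : Nat.card C ∣ n) {x c : U}
    (hx : x ∈ Subgroup.normalizer (C : Set U)) (hxn : x ^ n ∈ Subgroup.centralizer (C : Set U))
    (hc : c ∈ C) : (x * c) ^ n = x ^ n := by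
  rcases eq_or_ne n 0 with rfl | hn
  · simp only [pow_zero]
  have : Finite C := (Nat.card_ne_zero.mp (ne_zero_of_dvd_ne_zero hn hC)).2
  let π := conjMulPerm C ⟨x, hx⟩ ⟨c, hc⟩
  have hcomm (u : U) (hu : u ∈ C) : Commute (x ^ n) u := (hxn u hu).symm
  have hperiod (u : C) :
      n * orderOf ((x ^ n)⁻¹ * (x * c) ^ n) ∣ n.lcm (Function.minimalPeriod π u) := by
    refine mul_orderOf_dvd_lcm_of_semiconjBy (x := x) (y := x * c) (u := u) ?_ (hcomm u u.2)
      ((Commute.pow_self x n).mul_right (hcomm c hc))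
    have hfix := coe_conjMulPerm_iterate C ⟨x, hx⟩ ⟨c, hc⟩ u (Function.minimalPeriod π u)
    rw [Function.iterate_minimalPeriod, mul_assoc, eq_inv_mul_iff_mul_eq] at hfix
    exact hfix.symm
  -- A prime `p` dividing this order would force every cycle length of `π`, hence `|C|`, to be
  -- divisible by a higher power of `p` than `n` is.
  have horder : orderOf ((x ^ n)⁻¹ * (x * c) ^ n) = 1 := by
    refine Nat.eq_one_iff_not_exists_prime_dvd.mpr fun p hp hpz => ?_
    have hdvd : p ^ (n.factorization p + 1) ∣ Nat.card C :=
      dvd_natCard_of_dvd_minimalPeriod π fun u =>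
        pow_factorization_add_one_dvd_of_mul_dvd_lcm hp hn
          ((mul_dvd_mul_left n hpz).trans (hperiod u))
    exact Nat.pow_succ_factorization_not_dvd hn hp (hdvd.trans hC)
  exact (inv_mul_eq_one.mp (orderOf_eq_one_iff.mp horder)).symm

end PowMulCoset

section Twist

variable {F : Type v} {U : Type u} [Group F] [Group U] {H : Subgroup U} {N : Subgroup F}
  {φ ψ χ : F →* U}

/-- The largest subgroup of `H` normalised by the image of `φ`. -/
def homCore (H : Subgroup U) (φ : F →* U) : Subgroup U :=
  ⨅ f, H.comap (MulAut.conj (φ f)).toMonoidHom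

theorem mem_homCore {u : U} : u ∈ homCore H φ ↔ ∀ f, φ f * u * (φ f)⁻¹ ∈ H := by
  simp [homCore, Subgroup.mem_iInf]

theorem homCore_le (H : Subgroup U) (φ : F →* U) : homCore H φ ≤ H := fun u hu => by
  simpa using mem_homCore.mp hu 1

theorem range_le_normalizer_homCore (H : Subgroup U) (φ : F →* U) :
    φ.range ≤ Subgroup.normalizer (homCore H φ : Set U) := by
  rw [Subgroup.le_normalizer_iff]
  rintro _ ⟨f, rfl⟩ u hu
  rw [mem_homCore] at hu ⊢
  intro g
  simpa [mul_assoc] using hu (g * f)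

/-- Two homomorphisms are twists of each other if they agree on `N` and coincide modulo the
core of `H`. With `N` the kernel of a grading of a free group, twisting is what preserves the
solutions of homogeneous equations. -/
structure TwistRel (H : Subgroup U) (N : Subgroup F) (φ ψ : F →* U) : Prop where
  eqOn : ∀ f ∈ N, φ f = ψ f
  inv_mul_mem : ∀ f, (φ f)⁻¹ * ψ f ∈ homCore H φ

namespace TwistRel

theorem refl (φ : F →* U) : TwistRel H N φ φ where
  eqOn _ _ := rfl
  inv_mul_mem f := by simp

theorem homCore_le (h : TwistRel H N φ ψ) : homCore H φ ≤ homCore H ψ := by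
  intro u hu
  rw [mem_homCore]
  intro f
  have hδ := h.inv_mul_mem f
  have hconj := mem_homCore.mp (mul_mem (mul_mem hδ hu) (inv_mem hδ)) f
  simpa [mul_assoc] using hconj

theorem symm (h : TwistRel H N φ ψ) : TwistRel H N ψ φ where
  eqOn f hf := (h.eqOn f hf).symm
  inv_mul_mem f := by simpa using h.homCore_le (inv_mem (h.inv_mul_mem f))

theorem trans (h : TwistRel H N φ ψ) (h' : TwistRel H N ψ χ) : TwistRel H N φ χ where
  eqOn f hf := (h.eqOn f hf).trans (h'.eqOn f hf)
  inv_mul_mem f := by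
    simpa using mul_mem (h.inv_mul_mem f) (h.symm.homCore_le (h'.inv_mul_mem f))

theorem conj (h : TwistRel H N φ ψ) {u : U} (hu : u ∈ H) :
    TwistRel H N ((MulAut.conj u).toMonoidHom.comp φ) ((MulAut.conj u).toMonoidHom.comp ψ) where
  eqOn f hf := by simp [h.eqOn f hf]
  inv_mul_mem f := by
    rw [mem_homCore]
    intro g
    have hH := mul_mem (mul_mem hu (mem_homCore.mp (h.inv_mul_mem f) g)) (inv_mem hu)
    simpa [mul_assoc] using hH

end TwistRel

/-- The twist relation, as a setoid on the homomorphisms. -/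
def twistSetoid (H : Subgroup U) (N : Subgroup F) : Setoid (F →* U) where
  r := TwistRel H N
  iseqv := ⟨.refl, .symm, .trans⟩

/-- The elements of the core of `H` that centralise the image of `N`: they parametrise the twists
of `φ`, and form the stabiliser in `H` of the class of these twists. -/
def coreCentralizer (H : Subgroup U) (N : Subgroup F) (φ : F →* U) : Subgroup U :=
  homCore H φ ⊓ Subgroup.centralizer (φ '' N)

theorem mem_coreCentralizer {u : U} :
    u ∈ coreCentralizer H N φ ↔ u ∈ homCore H φ ∧ ∀ f ∈ N, Commute (φ f) u := by
  simp [coreCentralizer, Subgroup.mem_inf, Subgroup.mem_centralizer_iff, commute_iff_eq]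

theorem coreCentralizer_le (H : Subgroup U) (N : Subgroup F) (φ : F →* U) :
    coreCentralizer H N φ ≤ H :=
  inf_le_left.trans (homCore_le H φ)

theorem range_le_normalizer_coreCentralizer (H : Subgroup U) (N : Subgroup F) [N.Normal]
    (φ : F →* U) : φ.range ≤ Subgroup.normalizer (coreCentralizer H N φ : Set U) := by
  refine (le_inf (range_le_normalizer_homCore H φ) ?_).trans
    Subgroup.inf_normalizer_le_normalizer_inf
  rw [Subgroup.le_normalizer_iff]
  rintro _ ⟨f, rfl⟩ u hu _ ⟨g, hg, rfl⟩
  have hcomm := hu _ ⟨_, ‹N.Normal›.conj_mem' g hg f, rfl⟩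
  simp only [map_mul, map_inv] at hcomm
  calc φ g * (φ f * u * (φ f)⁻¹) = φ f * ((φ f)⁻¹ * φ g * φ f * u) * (φ f)⁻¹ := by group
    _ = φ f * u * (φ f)⁻¹ * φ g := by rw [hcomm]; group

theorem twistRel_conj_iff {u : U} (hu : u ∈ H) :
    TwistRel H N φ ((MulAut.conj u).toMonoidHom.comp φ) ↔ u ∈ coreCentralizer H N φ := by
  rw [mem_coreCentralizer]
  refine ⟨fun h => ⟨mem_homCore.mpr fun f => ?_, fun f hf => ?_⟩,
    fun h => ⟨fun f hf => ?_, fun f => ?_⟩⟩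
  · simpa [mul_assoc] using mul_mem (homCore_le H φ (h.inv_mul_mem f⁻¹)) hu
  · exact eq_mul_inv_iff_mul_eq.mp (h.eqOn f hf)
  · exact eq_mul_inv_of_mul_eq (h.2 f hf).eq
  · have hconj := (Subgroup.mem_normalizer_iff''.mp
      (range_le_normalizer_homCore H φ ⟨f, rfl⟩) u).mp h.1
    simpa [mul_assoc] using mul_mem hconj (inv_mem h.1)

theorem TwistRel.inv_mul_mem_coreCentralizer [N.Normal] (h : TwistRel H N φ ψ) (t : F) :
    (φ t)⁻¹ * ψ t ∈ coreCentralizer H N φ := by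
  refine mem_coreCentralizer.mpr ⟨h.inv_mul_mem t, fun f hf => ?_⟩
  have hconj := h.eqOn _ (‹N.Normal›.conj_mem f hf t)
  simp only [map_mul, map_inv, ← h.eqOn f hf] at hconj
  calc φ f * ((φ t)⁻¹ * ψ t) = (φ t)⁻¹ * (φ t * φ f * (φ t)⁻¹) * ψ t := by group
    _ = (φ t)⁻¹ * ψ t * φ f := by rw [hconj]; group

theorem inv_zpow_mul_zpow_mem {C : Subgroup U} {x c : U}
    (hx : x ∈ Subgroup.normalizer (C : Set U)) (hc : c ∈ C) (k : ℤ) :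
    (x ^ k)⁻¹ * (x * c) ^ k ∈ C := by
  let x' : Subgroup.normalizer (C : Set U) := ⟨x, hx⟩
  let c' : Subgroup.normalizer (C : Set U) := ⟨c, Subgroup.le_normalizer hc⟩
  have hcoset : (x' : _ ⧸ C.subgroupOf (Subgroup.normalizer (C : Set U))) = (x' * c' : _) :=
    QuotientGroup.eq.mpr (by simpa [Subgroup.mem_subgroupOf, c'] using hc)
  have hpow : ((x' ^ k : _) : _ ⧸ C.subgroupOf (Subgroup.normalizer (C : Set U))) =
      ((x' * c') ^ k : _) := by
    rw [QuotientGroup.mk_zpow, QuotientGroup.mk_zpow, ← hcoset]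
  exact Subgroup.mem_subgroupOf.mp (QuotientGroup.eq.mp hpow)

section Grading

variable {n : ℕ} {D : F →* Multiplicative (ZMod n)} {t : F}

theorem map_mul_inv_zpow_eq_one (ht : D t = .ofAdd 1) {f : F} {k : ℤ}
    (hf : D f = .ofAdd (k : ZMod n)) : D (f * (t ^ k)⁻¹) = 1 := by
  rw [map_mul, map_inv, map_zpow, ht, hf, ← ofAdd_zsmul, zsmul_one, mul_inv_cancel]

theorem inv_zpow_mul_zpow_eq_of_intCast_eq {x y : U} (hxy : y ^ n = x ^ n) {k l : ℤ}
    (hkl : (k : ZMod n) = l) : (x ^ k)⁻¹ * y ^ k = (x ^ l)⁻¹ * y ^ l := by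
  obtain ⟨j, hj⟩ := (ZMod.intCast_eq_intCast_iff_dvd_sub k l n).mp hkl
  obtain rfl : l = n * j + k := by lia
  rw [zpow_add, zpow_add, zpow_mul, zpow_mul, zpow_natCast, zpow_natCast, hxy]
  group

-- The cocycle `k ↦ (φ t)⁻ᵏ yᵏ` is well defined modulo `n` because `yⁿ = (φ t)ⁿ`.
theorem exists_monoidHom_apply_eq_mul_inv_zpow_mul_zpow (ht : D t = .ofAdd 1) {y : U}
    (hy : y ^ n = φ t ^ n) (hcomm : ∀ f ∈ D.ker, ∀ k : ℤ, Commute (φ f) ((φ t ^ k)⁻¹ * y ^ k)) :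
    ∃ ψ : F →* U, ∀ f (k : ℤ), D f = .ofAdd (k : ZMod n) →
      ψ f = φ f * ((φ t ^ k)⁻¹ * y ^ k) := by
  let δ (a : ZMod n) : U := (φ t ^ (a.cast : ℤ))⁻¹ * y ^ (a.cast : ℤ)
  have hδ (k : ℤ) : δ k = (φ t ^ k)⁻¹ * y ^ k :=
    inv_zpow_mul_zpow_eq_of_intCast_eq hy (ZMod.intCast_zmod_cast _)
  refine ⟨MonoidHom.mk' (fun f => φ f * δ (D f).toAdd) fun f g => ?_, fun f k hf => ?_⟩
  · obtain ⟨k, hk⟩ := ZMod.intCast_surjective (D f).toAdd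
    obtain ⟨l, hl⟩ := ZMod.intCast_surjective (D g).toAdd
    have hg := (hcomm _ (map_mul_inv_zpow_eq_one ht (k := l) (by rw [hl, ofAdd_toAdd])) k).eq
    simp only [map_mul, map_inv, map_zpow] at hg
    rw [map_mul, map_mul, toAdd_mul, ← hk, ← hl, ← Int.cast_add, hδ, hδ, hδ]
    calc φ f * φ g * ((φ t ^ (k + l))⁻¹ * y ^ (k + l))
        = φ f * (φ g * (φ t ^ l)⁻¹ * ((φ t ^ k)⁻¹ * y ^ k)) * y ^ l := by
          simp only [zpow_add, mul_inv_rev, mul_assoc]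
      _ = φ f * ((φ t ^ k)⁻¹ * y ^ k) * (φ g * ((φ t ^ l)⁻¹ * y ^ l)) := by
          rw [hg]; simp only [mul_assoc]
  · simp only [MonoidHom.mk'_apply, hf, toAdd_ofAdd, hδ]

theorem exists_twistRel_apply_eq_mul (ht : D t = .ofAdd 1) {c : U}
    (hc : c ∈ coreCentralizer H D.ker φ) (hcn : (φ t * c) ^ n = φ t ^ n) :
    ∃ ψ, TwistRel H D.ker φ ψ ∧ ψ t = φ t * c := by
  have hδ (k : ℤ) := mem_coreCentralizer.mp (inv_zpow_mul_zpow_mem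
    (range_le_normalizer_coreCentralizer H D.ker φ ⟨t, rfl⟩) hc k)
  obtain ⟨ψ, hψ⟩ := exists_monoidHom_apply_eq_mul_inv_zpow_mul_zpow ht hcn fun f hf k =>
    (hδ k).2 f hf
  refine ⟨ψ, ⟨fun f hf => ?_, fun f => ?_⟩, ?_⟩
  · simpa using (hψ f 0 (by simpa using hf)).symm
  · obtain ⟨k, hk⟩ := ZMod.intCast_surjective (D f).toAdd
    rw [hψ f k (by rw [hk, ofAdd_toAdd]), inv_mul_cancel_left]
    exact (hδ k).1
  · simpa using hψ t 1 (by simpa using ht)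

theorem TwistRel.eq_of_apply_eq (ht : D t = .ofAdd 1) (h : TwistRel H D.ker φ ψ)
    (htψ : φ t = ψ t) : φ = ψ := by
  ext f
  obtain ⟨k, hk⟩ := ZMod.intCast_surjective (D f).toAdd
  have hker := h.eqOn _ (map_mul_inv_zpow_eq_one ht (k := k) (by rw [hk, ofAdd_toAdd]))
  simpa [htψ] using hker

theorem nonempty_twistRel_equiv_coreCentralizer (ht : D t = .ofAdd 1) (hH : Nat.card H ∣ n)
    (φ : F →* U) : Nonempty ({ψ // TwistRel H D.ker φ ψ} ≃ coreCentralizer H D.ker φ) := by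
  refine ⟨.ofBijective
    (fun ψ => ⟨(φ t)⁻¹ * ψ.1 t, ψ.2.inv_mul_mem_coreCentralizer t⟩) ⟨?_, ?_⟩⟩
  · rintro ⟨ψ, hψ⟩ ⟨χ, hχ⟩ h
    exact Subtype.ext ((hψ.symm.trans hχ).eq_of_apply_eq ht
      (mul_left_cancel (congrArg Subtype.val h)))
  · rintro ⟨c, hc⟩
    have htn : t ^ n ∈ D.ker := by
      rw [MonoidHom.mem_ker, map_pow, ht, ← ofAdd_nsmul, nsmul_one, ZMod.natCast_self, ofAdd_zero]
    have hpow : (φ t * c) ^ n = φ t ^ n :=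
      mul_pow_eq_pow_of_natCard_dvd
        ((Subgroup.card_dvd_of_le (coreCentralizer_le H D.ker φ)).trans hH)
        (range_le_normalizer_coreCentralizer H D.ker φ ⟨t, rfl⟩)
        (fun u hu => by
          simpa using ((mem_coreCentralizer.mp hu).2 _ htn).symm.eq) hc
    obtain ⟨ψ, hψ, hψt⟩ := exists_twistRel_apply_eq_mul ht hc hpow
    exact ⟨⟨ψ, hψ⟩, Subtype.ext (by simp [hψt])⟩

/-- The action of a group on the homomorphisms into it by conjugation of their values. -/
abbrev conjMulAction : MulAction U (F →* U) where
  smul u φ := (MulAut.conj u).toMonoidHom.comp φ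
  one_smul φ := MonoidHom.ext fun f => by
    change MulAut.conj 1 (φ f) = φ f
    simp
  mul_smul u v φ := MonoidHom.ext fun f => by
    change MulAut.conj (u * v) (φ f) = MulAut.conj u (MulAut.conj v (φ f))
    simp

theorem lift_mk_dvd_mk_of_conj_of_twistRel (hD : Function.Surjective D) (hH : Nat.card H ∣ n)
    {Φ : Set (F →* U)} (hconj : ∀ u ∈ H, ∀ φ ∈ Φ, (MulAut.conj u).toMonoidHom.comp φ ∈ Φ)
    (htwist : ∀ φ ∈ Φ, ∀ ψ, TwistRel H D.ker φ ψ → ψ ∈ Φ) : lift.{v} #H ∣ #Φ := by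
  obtain ⟨t, ht⟩ := hD (.ofAdd 1)
  let _ : MulAction U (F →* U) := conjMulAction
  let A : SubMulAction H (F →* U) := ⟨Φ, fun u {φ} hφ => hconj u u.2 φ hφ⟩
  have key := lift_mk_dvd_lift_mk_of_class_equiv_stabilizer (K := H) (X := A)
    ((twistSetoid H D.ker).comap Subtype.val) (fun u _ _ h => h.conj u.2) fun φ => ?_
  · rwa [lift_umax.{u, v}, lift_id'.{u, v}] at key
  obtain ⟨e⟩ := nonempty_twistRel_equiv_coreCentralizer ht hH φ.1
  let twists : {y : A // TwistRel H D.ker φ.1 y.1} ≃ {ψ // TwistRel H D.ker φ.1 ψ} :=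
    { toFun y := ⟨y.1.1, y.2⟩
      invFun ψ := ⟨⟨ψ.1, htwist _ φ.2 _ ψ.2⟩, ψ.2⟩ }
  let stab : coreCentralizer H D.ker φ.1 ≃
      {u : H // TwistRel H D.ker φ.1 ((MulAut.conj (u : U)).toMonoidHom.comp φ.1)} :=
    { toFun u := ⟨⟨u, coreCentralizer_le H _ _ u.2⟩, (twistRel_conj_iff
        (coreCentralizer_le H _ _ u.2)).mpr u.2⟩
      invFun u := ⟨u.1, (twistRel_conj_iff u.1.2).mp u.2⟩ }
  exact ⟨twists.trans (e.trans stab)⟩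

end Grading

end Twist

section Degrees

theorem exists_surjective_linearMap_of_not_isTorsion {A M : Type*} [CommRing A] [IsDomain A]
    [IsPrincipalIdealRing A] [AddCommGroup M] [Module A M] [Module.Finite A M]
    (h : ¬ Module.IsTorsion A M) : ∃ f : M →ₗ[A] A, Function.Surjective f := by
  have : Nontrivial (M ⧸ Submodule.torsion A M) := by
    contrapose! h
    rw [Submodule.Quotient.subsingleton_iff] at h
    exact (Submodule.isTorsion'_iff_torsion'_eq_top _).mpr h
  let b := Module.Free.chooseBasis A (M ⧸ Submodule.torsion A M)
  obtain ⟨i⟩ := b.index_nonempty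
  have hcoord : Function.Surjective (b.coord i) := fun a => ⟨a • b i, by simp⟩
  exact ⟨(b.coord i).comp (Submodule.torsion A M).mkQ,
    hcoord.comp (Submodule.mkQ_surjective _)⟩

variable {ι : Type*}

theorem closure_range_eq_top_iff_surjective_linearCombination [Fintype ι] {A : Type*}
    [AddCommGroup A] (v : ι → A) :
    AddSubgroup.closure (Set.range v) = ⊤ ↔
      Function.Surjective (Fintype.linearCombination ℤ v) := by
  rw [← LinearMap.range_eq_top, Fintype.range_linearCombination,
    ← Submodule.toAddSubgroup_inj, Submodule.span_int_eq_addSubgroupClosure]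
  rfl

theorem surjective_lift_ofAdd_of_closure_range_eq_top {A : Type*} [AddGroup A] {v : ι → A}
    (hv : AddSubgroup.closure (Set.range v) = ⊤) :
    Function.Surjective (FreeGroup.lift fun i => Multiplicative.ofAdd (v i)) := by
  rw [FreeGroup.lift_surjective_iff_closure_range_eq_top]
  have h := AddSubgroup.toSubgroup_closure (Set.range v)
  rw [hv, map_top] at h
  rw [h, ← Equiv.image_symm_eq_preimage, ← Set.range_comp]
  rfl

variable {R : Type u} {m n : ℕ}

namespace RingMonomial

/-- The vector of the total exponents of the unknowns in a monomial. -/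
def totalExponents (t : RingMonomial R m) : Fin m → ℤ :=
  (t.map fun f => Pi.single f.unknown f.exponent).sum

theorem degree_eq_linearCombination (t : RingMonomial R m) (deg : Fin m → ZMod n) :
    t.degree deg = Fintype.linearCombination ℤ deg t.totalExponents := by
  simp [degree, totalExponents, map_list_sum, Function.comp_def,
    Fintype.linearCombination_apply_single]

end RingMonomial

namespace RingSystem

variable {S : RingSystem R m}

/-- The group of relations on the degrees of the unknowns imposed by homogeneity: it is generated
by the differences of the exponent vectors of two monomials of one equation. -/
def relationModule (S : RingSystem R m) : Submodule ℤ (Fin m → ℤ) :=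
  Submodule.span ℤ {v | ∃ e ∈ S, ∃ s ∈ e, ∃ t ∈ e,
    v = RingMonomial.totalExponents s - RingMonomial.totalExponents t}

theorem relationModule_le_ker_iff (deg : Fin m → ZMod n) :
    S.relationModule ≤ (Fintype.linearCombination ℤ deg).ker ↔
      ∀ e ∈ S, ∃ d, ∀ t ∈ e, RingMonomial.degree t deg = d := by
  have hker : S.relationModule ≤ (Fintype.linearCombination ℤ deg).ker ↔
      ∀ e ∈ S, ∀ s ∈ e, ∀ t ∈ e, RingMonomial.degree s deg = RingMonomial.degree t deg := by
    rw [relationModule, Submodule.span_le]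
    refine ⟨fun h e he s hs t ht => ?_, ?_⟩
    · have hst := h ⟨e, he, s, hs, t, ht, rfl⟩
      rwa [SetLike.mem_coe, LinearMap.mem_ker, map_sub, sub_eq_zero,
        ← RingMonomial.degree_eq_linearCombination,
        ← RingMonomial.degree_eq_linearCombination] at hst
    · rintro h _ ⟨e, he, s, hs, t, ht, rfl⟩
      rw [SetLike.mem_coe, LinearMap.mem_ker, map_sub, sub_eq_zero,
        ← RingMonomial.degree_eq_linearCombination, ← RingMonomial.degree_eq_linearCombination]
      exact h e he s hs t ht
  rw [hker]
  refine forall₂_congr fun e _ =>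
    ⟨fun h => ?_, fun ⟨d, hd⟩ s hs t ht => (hd s hs).trans (hd t ht).symm⟩
  rcases e with _ | ⟨s, e⟩
  · exact ⟨0, by simp⟩
  · exact ⟨RingMonomial.degree s deg, fun t ht => h t ht s List.mem_cons_self⟩

theorem isHomogeneousMod_iff_exists_surjective :
    S.IsHomogeneousMod n ↔
      ∃ f : ((Fin m → ℤ) ⧸ S.relationModule) →ₗ[ℤ] ZMod n, Function.Surjective f := by
  simp only [IsHomogeneousMod, closure_range_eq_top_iff_surjective_linearCombination,
    ← relationModule_le_ker_iff]
  constructor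
  · rintro ⟨deg, hsurj, hker⟩
    refine ⟨S.relationModule.liftQ _ hker, fun a => ?_⟩
    obtain ⟨v, hv⟩ := hsurj a
    exact ⟨S.relationModule.mkQ v, hv⟩
  · rintro ⟨f, hf⟩
    have hcomb : Fintype.linearCombination ℤ (fun i => f (S.relationModule.mkQ (Pi.single i 1))) =
        f.comp S.relationModule.mkQ :=
      (Pi.basisFun ℤ (Fin m)).ext fun i => by simp [Fintype.linearCombination_apply_single]
    refine ⟨fun i => f (S.relationModule.mkQ (Pi.single i 1)), ?_, ?_⟩ <;> rw [hcomb]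
    · exact hf.comp (Submodule.mkQ_surjective _)
    · exact (Submodule.ker_mkQ _).ge.trans (LinearMap.ker_le_ker_comp _ _)

theorem isHomogeneousMod_one (S : RingSystem R m) : S.IsHomogeneousMod 1 :=
  ⟨0, Subsingleton.elim _ _, fun _ _ => ⟨0, fun _ _ => Subsingleton.elim _ _⟩⟩

theorem isHomogeneousMod_zero_of_infinite (h : {n | S.IsHomogeneousMod n}.Infinite) :
    S.IsHomogeneousMod 0 := by
  refine isHomogeneousMod_iff_exists_surjective.mpr
    (exists_surjective_linearMap_of_not_isTorsion fun htorsion => h ?_)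
  have := Module.finite_of_fg_torsion _ htorsion
  refine (Set.finite_Iic (Nat.card ((Fin m → ℤ) ⧸ S.relationModule))).subset fun n hn => ?_
  obtain ⟨f, hf⟩ := isHomogeneousMod_iff_exists_surjective.mp hn
  simpa using Nat.card_le_card_of_surjective f hf

theorem isHomogeneousMod_homogeneityModulus (S : RingSystem R m) :
    S.IsHomogeneousMod S.homogeneityModulus := by
  rw [homogeneityModulus]
  split_ifs with hfin
  · exact Nat.sSup_mem ⟨1, S.isHomogeneousMod_one⟩ hfin.bddAbove
  · exact isHomogeneousMod_zero_of_infinite hfin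

end RingSystem

end Degrees

section LCM

theorem cardinalLCM_dvd {A : Set Cardinal.{u}} {c : Cardinal.{u}} (h : ∀ a ∈ A, a ∣ c) :
    cardinalLCM A ∣ c := by
  rcases eq_or_ne c 0 with rfl | hc
  · exact dvd_zero _
  have hmem : cardinalLCM A ∈ {b | b ≠ 0 ∧ ∀ a ∈ A, a ∣ b} := csInf_mem ⟨c, hc, h⟩
  have hle {b : Cardinal.{u}} (hb : b ≠ 0) (hAb : ∀ a ∈ A, a ∣ b) : cardinalLCM A ≤ b :=
    csInf_le' ⟨hb, hAb⟩
  rcases le_or_gt ℵ₀ c with hinf | hfin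
  · exact dvd_of_le_of_aleph0_le hmem.1 (hle hc h) hinf
  obtain ⟨l, hl⟩ := lt_aleph0.mp ((hle hc h).trans_lt hfin)
  obtain ⟨k, rfl⟩ := lt_aleph0.mp hfin
  rw [hl] at hmem hle ⊢
  have hl0 : l ≠ 0 := mod_cast hmem.1
  have hgcd : ∀ a ∈ A, a ∣ (l.gcd k : Cardinal.{u}) := fun a ha => by
    obtain ⟨i, rfl⟩ := lt_aleph0.mp ((le_of_dvd hc (h a ha)).trans_lt hfin)
    exact nat_coe_dvd_iff.mpr
      (Nat.dvd_gcd (nat_coe_dvd_iff.mp (hmem.2 _ ha)) (nat_coe_dvd_iff.mp (h _ ha)))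
  have hl_le : l ≤ l.gcd k := mod_cast hle (mod_cast Nat.gcd_ne_zero_left hl0) hgcd
  have heq : l.gcd k = l := (Nat.gcd_le_left k (Nat.pos_of_ne_zero hl0)).antisymm hl_le
  exact nat_coe_dvd_iff.mpr (Nat.gcd_eq_left_iff_dvd.mp heq)

end LCM

section Equations

variable {R : Type u} {m : ℕ}

namespace RingMonomial

/-- The word of the free group obtained from a monomial by dropping the coefficients. -/
def word (t : RingMonomial R m) : FreeGroup (Fin m) :=
  (t.map fun f => FreeGroup.of f.unknown ^ f.exponent).prod

theorem word_cons (f : RingFactor R m) (t : RingMonomial R m) :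
    word (f :: t) = FreeGroup.of f.unknown ^ f.exponent * t.word :=
  List.prod_cons

theorem lift_word {n : ℕ} (t : RingMonomial R m) (deg : Fin m → ZMod n) :
    FreeGroup.lift (fun i => Multiplicative.ofAdd (deg i)) t.word = .ofAdd (t.degree deg) := by
  simp [word, degree, map_list_prod, ofAdd_list_prod, Function.comp_def, ← zsmul_eq_mul,
    ofAdd_zsmul]

variable [Ring R]

theorem eval_nil (x : Fin m → Rˣ) : eval ([] : RingMonomial R m) x = 1 :=
  rfl

theorem eval_cons (f : RingFactor R m) (t : RingMonomial R m) (x : Fin m → Rˣ) :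
    eval (f :: t) x = f.coeff * ((x f.unknown ^ f.exponent : Rˣ) : R) * t.eval x :=
  List.prod_cons

theorem eval_conj (t : RingMonomial R m) (x : Fin m → Rˣ) {u : Rˣ}
    (hu : ∀ f ∈ t, Commute f.coeff (u : R)) :
    t.eval (fun i => u * x i * u⁻¹) = u * t.eval x * (u⁻¹ : Rˣ) := by
  induction t with
  | nil => simp [eval_nil]
  | cons f t ih =>
    rw [List.forall_mem_cons] at hu
    rw [eval_cons, eval_cons, ih hu.2, conj_zpow]
    simp only [Units.val_mul, ← mul_assoc, hu.1.eq, Units.inv_mul_cancel_right]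

variable {φ ψ : FreeGroup (Fin m) →* Rˣ}

theorem mul_eval (t : RingMonomial R m) {u : Rˣ}
    (hu : ∀ f ∈ t, ∀ g, Commute f.coeff ((φ g * u * (φ g)⁻¹ : Rˣ) : R)) :
    u * t.eval (fun i => φ (.of i)) =
      t.eval (fun i => φ (.of i)) * ((φ t.word)⁻¹ * u * φ t.word : Rˣ) := by
  induction t generalizing u with
  | nil => simp [eval_nil, word]
  | cons f t ih =>
    rw [List.forall_mem_cons] at hu
    have hf : Commute f.coeff (u : R) := by simpa using hu.1 1
    rw [eval_cons, word_cons, ← map_zpow]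
    set g := FreeGroup.of f.unknown ^ f.exponent
    have ih' := ih (u := (φ g)⁻¹ * u * φ g) fun a ha w => by
      simpa [mul_assoc] using hu.2 a ha (w * g⁻¹)
    calc u * (f.coeff * φ g * eval t fun i => φ (.of i))
        = f.coeff * φ g * (((φ g)⁻¹ * u * φ g : Rˣ) * eval t fun i => φ (.of i)) := by
          simp only [← mul_assoc, ← hf.eq, Units.val_mul, Units.mul_inv_cancel_right]
      _ = _ := by
          rw [ih', map_mul]
          simp [mul_assoc]

theorem eval_eq_eval_mul (t : RingMonomial R m)
    (h : ∀ f ∈ t, ∀ g w, Commute f.coeff ((φ g * ((φ w)⁻¹ * ψ w) * (φ g)⁻¹ : Rˣ) : R)) :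
    t.eval (fun i => ψ (.of i)) =
      t.eval (fun i => φ (.of i)) * ((φ t.word)⁻¹ * ψ t.word : Rˣ) := by
  induction t with
  | nil => simp [eval_nil, word]
  | cons f t ih =>
    rw [List.forall_mem_cons] at h
    rw [eval_cons, eval_cons, word_cons, ih h.2, ← map_zpow, ← map_zpow]
    set g := FreeGroup.of f.unknown ^ f.exponent
    calc f.coeff * ψ g * (eval t (fun i => φ (.of i)) * ((φ (word t))⁻¹ * ψ (word t) : Rˣ))
        = f.coeff * φ g * (((φ g)⁻¹ * ψ g : Rˣ) * eval t fun i => φ (.of i)) *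
            ((φ (word t))⁻¹ * ψ (word t) : Rˣ) := by simp [mul_assoc]
      _ = _ := by
          rw [mul_eval t fun a ha w => h.2 a ha w g, map_mul, map_mul]
          simp [mul_assoc]

end RingMonomial

namespace RingEquation

variable [Ring R]

theorem eval_conj (e : RingEquation R m) (x : Fin m → Rˣ) {u : Rˣ}
    (hu : ∀ t ∈ e, ∀ f ∈ t, Commute f.coeff (u : R)) :
    e.eval (fun i => u * x i * u⁻¹) = u * e.eval x * (u⁻¹ : Rˣ) := by
  rw [eval, List.map_congr_left fun t ht => RingMonomial.eval_conj t x (hu t ht),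
    List.sum_map_mul_right, List.sum_map_mul_left, eval]

theorem exists_eval_eq_eval_mul (e : RingEquation R m) {φ ψ : FreeGroup (Fin m) →* Rˣ}
    (h : ∀ t ∈ e, ∀ f ∈ t, ∀ g w, Commute f.coeff ((φ g * ((φ w)⁻¹ * ψ w) * (φ g)⁻¹ : Rˣ) : R))
    (hword : ∀ s ∈ e, ∀ t ∈ e, φ (RingMonomial.word s * (RingMonomial.word t)⁻¹) =
      ψ (RingMonomial.word s * (RingMonomial.word t)⁻¹)) :
    ∃ r, e.eval (fun i => ψ (.of i)) = e.eval (fun i => φ (.of i)) * r := by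
  rcases e with _ | ⟨s, e⟩
  · exact ⟨0, by simp [eval]⟩
  have hratio : ∀ t ∈ s :: e, (φ (RingMonomial.word t))⁻¹ * ψ (RingMonomial.word t) =
      (φ (RingMonomial.word s))⁻¹ * ψ (RingMonomial.word s) := fun t ht => by
    have hts := hword t ht s List.mem_cons_self
    rw [map_mul, map_inv, map_mul, map_inv, mul_inv_eq_iff_eq_mul] at hts
    rw [hts]
    group
  refine ⟨((φ (RingMonomial.word s))⁻¹ * ψ (RingMonomial.word s) : Rˣ), ?_⟩
  rw [eval, eval, ← List.sum_map_mul_right]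
  exact congrArg List.sum (List.map_congr_left fun t ht => by
    rw [RingMonomial.eval_eq_eval_mul t (h t ht), hratio t ht])

end RingEquation

namespace RingSystem

variable [Ring R] {S : RingSystem R m} {n : ℕ} {G : Subgroup Rˣ} {H : Subgroup G}

theorem conj_mem_solutions {u : G} (hu : ∀ c ∈ S.coeffs, Commute c ((u : Rˣ) : R))
    {x : Fin m → G} (hx : x ∈ S.solutions G) : (fun i => u * x i * u⁻¹) ∈ S.solutions G :=
  fun e he => (RingEquation.eval_conj e (fun i => (x i : Rˣ)) (u := u) fun t ht f hf =>
    hu _ ⟨e, he, t, ht, f, hf, rfl⟩).trans (by rw [hx e he, mul_zero, zero_mul])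

theorem mem_solutions_of_twistRel {deg : Fin m → ZMod n}
    (hdeg : ∀ e ∈ S, ∃ d, ∀ t ∈ e, RingMonomial.degree t deg = d)
    (hH : ∀ u ∈ H, ∀ c ∈ S.coeffs, Commute c ((u : Rˣ) : R)) {φ ψ : FreeGroup (Fin m) →* G}
    (h : TwistRel H (FreeGroup.lift fun i => Multiplicative.ofAdd (deg i)).ker φ ψ)
    (hφ : (fun i => φ (.of i)) ∈ S.solutions G) : (fun i => ψ (.of i)) ∈ S.solutions G := by
  intro e he
  obtain ⟨d, hd⟩ := hdeg e he
  obtain ⟨r, hr⟩ := RingEquation.exists_eval_eq_eval_mul e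
    (φ := G.subtype.comp φ) (ψ := G.subtype.comp ψ)
    (fun t ht f hf g w => hH _ (mem_homCore.mp (h.inv_mul_mem w) g) _ ⟨e, he, t, ht, f, hf, rfl⟩)
    (fun s hs t ht => congrArg G.subtype (h.eqOn _ (by
      rw [MonoidHom.mem_ker, map_mul, map_inv, RingMonomial.lift_word, RingMonomial.lift_word,
        hd s hs, hd t ht, mul_inv_cancel])))
  exact hr.trans ((congrArg (· * r) (hφ e he)).trans (zero_mul r))

theorem IsHomogeneousMod.mk_dvd_mk_solutions (hS : S.IsHomogeneousMod n)
    (hH : ∀ u ∈ H, ∀ c ∈ S.coeffs, Commute c ((u : Rˣ) : R)) (hn : #H ∣ (n : Cardinal.{u})) :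
    #H ∣ #(S.solutions G) := by
  obtain ⟨deg, hgen, hdeg⟩ := hS
  have hcard : Nat.card H ∣ n := toNat_natCast n ▸ map_dvd toNat hn
  rw [← mk_preimage_equiv FreeGroup.lift.symm (S.solutions G)]
  simpa using lift_mk_dvd_mk_of_conj_of_twistRel
    (surjective_lift_ofAdd_of_closure_range_eq_top hgen) hcard
    (Φ := FreeGroup.lift.symm ⁻¹' S.solutions G)
    (fun u hu _ hφ => conj_mem_solutions (hH u hu) hφ)
    (fun _ hφ _ h => mem_solutions_of_twistRel hdeg hH h hφ)

theorem IsHomogeneousMod.groupGCD_dvd_mk_solutions (hS : S.IsHomogeneousMod n) :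
    groupGCD (G ⊓ (Submonoid.centralizer S.coeffs).units : Subgroup Rˣ) n ∣ #(S.solutions G) := by
  refine cardinalLCM_dvd ?_
  rintro _ ⟨H, rfl, hn⟩
  let incl := Subgroup.inclusion (inf_le_left : G ⊓ (Submonoid.centralizer S.coeffs).units ≤ G)
  have hmk : #H = #(H.map incl) :=
    mk_congr (H.equivMapOfInjective incl (Subgroup.inclusion_injective _)).toEquiv
  rw [hmk] at hn ⊢
  refine hS.mk_dvd_mk_solutions ?_ hn
  rintro _ ⟨u, -, rfl⟩ c hc
  exact Submonoid.mem_centralizer_iff.mp ((Submonoid.mem_units_iff _ _).mp u.2.2).1 c hc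

end RingSystem

end Equations

theorem theorem3 {R : Type u} [Ring R] (G : Subgroup Rˣ) (m : ℕ) (S : RingSystem R m) :
    groupGCD (G ⊓ (Submonoid.centralizer S.coeffs).units : Subgroup Rˣ) S.homogeneityModulus ∣
      Cardinal.mk (S.solutions G) :=
  S.isHomogeneousMod_homogeneityModulus.groupGCD_dvd_mk_solutions
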